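/- **Setting.** Let $\mathbb{Z}_-=\{\dots,-2,-1,0\}$, let $D_d\subset\mathbb{R}^d$ and $B_m\subset\mathbb{R}^m$ be compact, and let $\|\cdot\|$ be the Euclidean norm. For $\tau=0,1,2,\dots$ let $(T_\tau \boldsymbol z)_t=\boldsymbol z_{t-\tau}$, $t\in\mathbb{Z}_-$. A filter $U\colon (D_d)^{\mathbb{Z}_-}\to(B_m)^{\mathbb{Z}_-}$ is *causal* if $U(\boldsymbol z)_t=U(\boldsymbol w)_t$ whenever $\boldsymbol z_s=\boldsymbol w_s$ for all $s\le t$; it is *time-invariant* if $U\circ T_\tau=T_\tau\circ U$ for all $\tau\geq 0$; it has the *fading memory property* if it is continuous for the product topologies. A state map $F\colon\mathbb{R}^N\times\mathbb{R}^d\to\mathbb{R}^N$ has the *echo state property* (for inputs in $(D_d)^{\mathbb{Z}_-}$) if for every $\boldsymbol z\in(D_d)^{\mathbb{Z}_-}$ there is exactly one $\boldsymbol x\in(\mathbb{R}^N)^{\mathbb{Z}_-}$ with $\boldsymbol x_t=F(\boldsymbol x_{t-1},\boldsymbol z_t)$ for all $t\in\mathbb{Z}_-$. **Circuit.** For an integer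 $n\ge 1$ let $\boldsymbol\Theta=(\mathbb{R}^{N+d}\times\mathbb{R}\times[0,2\pi])^n$. For $\boldsymbol\theta=(\boldsymbol a^i,b^i,\gamma^i)_{i=1,\dots,n}\in\boldsymbol\Theta$ and $(\boldsymbol x,\boldsymbol z)\in\mathbb{R}^N\times\mathbb{R}^d$ put, with the rotation gates $$\mathtt R_{\mathrm y}(\gamma)=\begin{pmatrix}\cos\frac{\gamma}{2}&-\sin\frac{\gamma}{2}\\ \sin\frac{\gamma}{2}&\cos\frac{\gamma}{2}\end{pmatrix},\qquad \mathtt R_{\mathrm z}(\alpha)=\begin{pmatrix}e^{-\mathrm i\alpha/2}&0\\0&e^{\mathrm i\alpha/2}\end{pmatrix}$$ and the Hadamard gate $\mathtt H=\frac{1}{\sqrt2}\begin{pmatrix}1&1\\1&-1\end{pmatrix}$, $$\mathtt U_1^{(i)}(\boldsymbol x,\boldsymbol z)=\mathtt H\,\mathtt R_{\mathrm z}(-b^i)\,\mathtt R_{\mathrm z}(-a^i_{N+d}z_d)\cdots\mathtt R_{\mathrm z}(-a^i_{N+1}z_1)\,\mathtt R_{\mathrm z}(-a^i_Nx_N)\cdots\mathtt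 R_{\mathrm z}(-a^i_1x_1)\,\mathtt H,\qquad \mathtt U_2^{(i)}=\mathtt R_{\mathrm y}(\gamma^i).$$ Let $2^{c}$ be the smallest power of two with $2^{c}\ge n$. On $c+2$ qubits (with basis $|i\rangle\otimes|m\rangle=|4i+m\rangle$, $0\le i<2^c$, $m\in\{0,1,2,3\}$) let $$\mathtt U_{\boldsymbol\theta}(\boldsymbol x,\boldsymbol z)=\sum_{i=0}^{n-1}|i\rangle\langle i|\otimes \mathtt U_1^{(i+1)}(\boldsymbol x,\boldsymbol z)\otimes\mathtt U_2^{(i+1)}+\sum_{i=n}^{2^c-1}|i\rangle\langle i|\otimes\mathbf 1_{4\times 4},$$ and let $\mathtt V=\mathtt V_n$ be any fixed unitary matrix with $\mathtt V|0\rangle=\frac1{\sqrt n}\sum_{i=0}^{n-1}|4i\rangle$. Write $$\mathbb P^{n,\boldsymbol\theta}_m(\boldsymbol x,\boldsymbol z)=\sum_{i=0}^{n-1}\bigl|\langle 4i+m|\,\mathtt U_{\boldsymbol\theta}(\boldsymbol x,\boldsymbol z)\,\mathtt V\,|0\rangle\bigr|^2$$ for the probability that measuring the final state yields an element of $\{m,4+m,\dots,4(n-1)+m\}$.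 For $R>0$, $P_1,\dots,P_N\in\mathbb{R}^{N\times N}$ and $\boldsymbol\theta=(\boldsymbol\theta^1,\dots,\boldsymbol\theta^N)\in\boldsymbol\Theta^N$, the *modified RQNN* is the state-space system $\hat{\boldsymbol x}_t=\tilde F^{n,\boldsymbol\theta}_R(\hat{\boldsymbol x}_{t-1},\boldsymbol z_t)$, $t\in\mathbb{Z}_-$, whose state map has the components $$\tilde F^{n,\boldsymbol\theta}_{R,j}(\boldsymbol x,\boldsymbol z)=R-2R\bigl[\mathbb P_1^{n,\boldsymbol\theta^j}(P_j\boldsymbol x,\boldsymbol z)+\mathbb P_2^{n,\boldsymbol\theta^j}(P_j\boldsymbol x,\boldsymbol z)\bigr],\qquad j=1,\dots,N.$$ **Theorem.** Let $U\colon(D_d)^{\mathbb{Z}_-}\to(B_m)^{\mathbb{Z}_-}$ be a causal and time-invariant filter with the fading memory property. Then for every $R>0$ and every $\varepsilon>0$ there exist integers $n,N\ge1$, matrices $P_1,\dots,P_N\in\mathbb{R}^{N\times N}$, a readout $W\in\mathbb{R}^{m\times N}$ and circuit parameters $\boldsymbol\theta\in\boldsymbol\Theta^N$ such that the modified RQNN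 has the echo state property and the filter $\bar U_W\colon(D_d)^{\mathbb{Z}_-}\to(\mathbb{R}^m)^{\mathbb{Z}_-}$, $\bar U_W(\boldsymbol z)_t=W\hat{\boldsymbol x}_t$, satisfies $$\sup_{\boldsymbol z\in(D_d)^{\mathbb{Z}_-}}\ \sup_{t\in\mathbb{Z}_-}\ \bigl\|U(\boldsymbol z)_t-\bar U_W(\boldsymbol z)_t\bigr\|\le\varepsilon .$$ -/

import Mathlib

open scoped Matrix Kronecker

noncomputable section

namespace RQNN

/-! ### Semi-infinite sequences and filters -/

/-- The index set `ℤ₋ = {…, -2, -1, 0}`. -/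
abbrev ZMinus : Type := {t : ℤ // t ≤ 0}

/-- The time `t - τ ∈ ℤ₋`, for `t ∈ ℤ₋` and `τ = 0, 1, 2, …`. -/
def ZMinus.back (τ : ℕ) (t : ZMinus) : ZMinus :=
  ⟨t.1 - (τ : ℤ), by have := t.2; omega⟩

/-- The time delay operator `T_τ`, `(T_τ z)_t = z_{t-τ}`, on sequences indexed by `ℤ₋`. -/
def timeDelay {X : Type*} (τ : ℕ) (z : ZMinus → X) : ZMinus → X :=
  fun t => z (ZMinus.back τ t)

/-- Causality: `U(z)_t` depends only on the entries `z_s` with `s ≤ t`. -/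
def IsCausal {X Y : Type*} (U : (ZMinus → X) → (ZMinus → Y)) : Prop :=
  ∀ (z w : ZMinus → X) (t : ZMinus), (∀ s : ZMinus, s ≤ t → z s = w s) → U z t = U w t

/-- Time invariance: `U` commutes with all time delay operators. -/
def IsTimeInvariant {X Y : Type*} (U : (ZMinus → X) → (ZMinus → Y)) : Prop :=
  ∀ (τ : ℕ) (z : ZMinus → X), U (timeDelay τ z) = timeDelay τ (U z)

/-- Fading memory: continuity for the product topologies on the sequence spaces
(the topologies that `ZMinus → X` and `ZMinus → Y` carry in Mathlib). -/
def HasFadingMemory {X Y : Type*} [TopologicalSpace X] [TopologicalSpace Y]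
    (U : (ZMinus → X) → (ZMinus → Y)) : Prop :=
  Continuous U

/-! ### State-space systems -/

/-- `x` solves the state equation `x_t = F(x_{t-1}, z_t)` for all `t ∈ ℤ₋`. -/
def IsStateSolution {S X : Type*} (F : S → X → S) (z : ZMinus → X) (x : ZMinus → S) : Prop :=
  ∀ t : ZMinus, x t = F (x (ZMinus.back 1 t)) (z t)

/-- Echo state property with respect to inputs in `D^{ℤ₋}`: every such input sequence admits
exactly one state sequence. -/
def EchoStateProperty {S X : Type*} (F : S → X → S) (D : Set X) : Prop :=
  ∀ z : ZMinus → D, ∃! x : ZMinus → S, IsStateSolution F (fun t => (z t : X)) x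

/-- The state filter `z ↦ x` of a system with the echo state property. -/
def stateFilter {S X : Type*} {F : S → X → S} {D : Set X} (h : EchoStateProperty F D)
    (z : ZMinus → D) : ZMinus → S :=
  (h z).choose

/-- The output filter `z ↦ y`, `y_t = W x_t`, of a system with the echo state property and
linear readout `W`, with values in `ℝ^m` with its Euclidean norm. -/
def outputFilter {N m : ℕ} {X : Type*} {F : (Fin N → ℝ) → X → (Fin N → ℝ)} {D : Set X}
    (h : EchoStateProperty F D) (W : Matrix (Fin m) (Fin N) ℝ)
    (z : ZMinus → D) : ZMinus → EuclideanSpace ℝ (Fin m) :=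
  fun t => WithLp.toLp 2 (W *ᵥ stateFilter h z t)

/-! ### Quantum gates -/

/-- Rotation around the Y-axis. -/
def gateRy (γ : ℝ) : Matrix (Fin 2) (Fin 2) ℂ :=
  !![(Real.cos (γ / 2) : ℂ), -(Real.sin (γ / 2) : ℂ);
     (Real.sin (γ / 2) : ℂ), (Real.cos (γ / 2) : ℂ)]

/-- Rotation around the Z-axis. -/
def gateRz (α : ℝ) : Matrix (Fin 2) (Fin 2) ℂ :=
  !![Complex.exp (-(Complex.I * ((α / 2 : ℝ) : ℂ))), 0;
     0, Complex.exp (Complex.I * ((α / 2 : ℝ) : ℂ))]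

/-- The Hadamard gate. -/
def gateH : Matrix (Fin 2) (Fin 2) ℂ :=
  ((1 / Real.sqrt 2 : ℝ) : ℂ) • !![1, 1; 1, -1]

/-- Parameters `(a, b, γ) ∈ ℝ^{N+d} × ℝ × [0, 2π]` of one gate block; the first `N` entries of `a`
multiply the state, the last `d` entries multiply the input. -/
structure GateParams (N d : ℕ) where
  a : Fin (N + d) → ℝ
  b : ℝ
  γ : Set.Icc (0 : ℝ) (2 * Real.pi)

/-- The parameter space `Θ` of a circuit with accuracy parameter `n`. -/
abbrev CircuitParams (n N d : ℕ) : Type := Fin n → GateParams N d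

/-- The gate `U₁(x, z) = H R_z(-b) R_z(-a_{N+d} z_d) ⋯ R_z(-a_{N+1} z_1) R_z(-a_N x_N) ⋯
R_z(-a_1 x_1) H`. -/
def gateU1 {N d : ℕ} (p : GateParams N d) (x : Fin N → ℝ) (z : EuclideanSpace ℝ (Fin d)) :
    Matrix (Fin 2) (Fin 2) ℂ :=
  gateH * gateRz (-p.b) *
    ((List.finRange d).reverse.map fun l => gateRz (-(p.a (Fin.natAdd N l) * z l))).prod *
    ((List.finRange N).reverse.map fun l => gateRz (-(p.a (Fin.castAdd d l) * x l))).prod *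
    gateH

/-- The gate `U₂ = R_y(γ)`. -/
def gateU2 {N d : ℕ} (p : GateParams N d) : Matrix (Fin 2) (Fin 2) ℂ :=
  gateRy p.γ

/-- The two-qubit gate `U₁(x, z) ⊗ U₂`. -/
def gateUBar {N d : ℕ} (p : GateParams N d) (x : Fin N → ℝ) (z : EuclideanSpace ℝ (Fin d)) :
    Matrix (Fin 2 × Fin 2) (Fin 2 × Fin 2) ℂ :=
  gateU1 p x z ⊗ₖ gateU2 p

/-! ### The circuit -/

/-- The number of control qubits, that is, the least `c` with `n ≤ 2 ^ c`. The `4 × 4` blocks of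
the circuit are thus padded to the least power of two `4 * 2 ^ c ≥ 4 n`. -/
def controlQubits (n : ℕ) : ℕ := Nat.clog 2 n

/-- The computational basis of the circuit with `controlQubits n + 2` qubits: the element
`(i, (j, k))` stands for `|i⟩ ⊗ |j⟩ ⊗ |k⟩ = |4 i + 2 j + k⟩`; the two target qubits
have the lowest order. -/
abbrev Basis (n : ℕ) : Type := Fin (2 ^ controlQubits n) × (Fin 2 × Fin 2)

/-- The initial state `|0⟩ ⊗ ⋯ ⊗ |0⟩`. -/
def ketZero (n : ℕ) : Basis n → ℂ := Pi.single (0, (0, 0)) 1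

/-- The state `|ψ⟩ = n^{-1/2} ∑_{i < n} |4 i⟩`. -/
def ketPsi (n : ℕ) : Basis n → ℂ := fun k =>
  if (k.1 : ℕ) < n ∧ k.2 = (0, 0) then ((1 / Real.sqrt n : ℝ) : ℂ) else 0

/-- `V` is a unitary gate with `V |0⟩ = |ψ⟩`. -/
structure IsPreparationGate (n : ℕ) (V : Matrix (Basis n) (Basis n) ℂ) : Prop where
  unitary : V ∈ Matrix.unitaryGroup (Basis n) ℂ
  map_ketZero : V *ᵥ ketZero n = ketPsi n

/-- The uniformly controlled gate
`U_θ(x, z) = ∑_{i < n} |i⟩⟨i| ⊗ Ū^{(i+1)}(x, z) + ∑_{i ≥ n} |i⟩⟨i| ⊗ 1`. -/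
def gateU {n N d : ℕ} (θ : CircuitParams n N d) (x : Fin N → ℝ)
    (z : EuclideanSpace ℝ (Fin d)) : Matrix (Basis n) (Basis n) ℂ :=
  Matrix.of fun k l =>
    if k.1 = l.1 then
      (if h : (k.1 : ℕ) < n then gateUBar (θ ⟨k.1, h⟩) x z k.2 l.2
        else (1 : Matrix (Fin 2 × Fin 2) (Fin 2 × Fin 2) ℂ) k.2 l.2)
    else 0

/-- The final state `U_θ(x, z) V |0⟩` of the circuit. -/
def circuitState {n N d : ℕ} (V : Matrix (Basis n) (Basis n) ℂ) (θ : CircuitParams n N d)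
    (x : Fin N → ℝ) (z : EuclideanSpace ℝ (Fin d)) : Basis n → ℂ :=
  (gateU θ x z * V) *ᵥ ketZero n

/-- The probability that measuring the final state in the computational basis gives one of
`|i⟩ ⊗ |m⟩`, `i < n`, where `m` is the state of the two target qubits. -/
def measureProb {n N d : ℕ} (V : Matrix (Basis n) (Basis n) ℂ) (θ : CircuitParams n N d)
    (m : Fin 2 × Fin 2) (x : Fin N → ℝ) (z : EuclideanSpace ℝ (Fin d)) : ℝ :=
  ∑ i : Fin (2 ^ controlQubits n),
    if (i : ℕ) < n then ‖circuitState V θ x z (i, m)‖ ^ 2 else 0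

/-- The state map of the modified recurrent quantum neural network: its `j`-th component is
`R - 2 R [ℙ₁(P_j x, z) + ℙ₂(P_j x, z)]`, the probabilities being those of the circuit
with parameters `θ j`. The outcomes `1` and `2` are `01` and `10` in binary. -/
def modStateMap {n N d : ℕ} (V : Matrix (Basis n) (Basis n) ℂ) (R : ℝ)
    (P : Fin N → Matrix (Fin N) (Fin N) ℝ) (θ : Fin N → CircuitParams n N d)
    (x : Fin N → ℝ) (z : EuclideanSpace ℝ (Fin d)) : Fin N → ℝ :=
  fun j => R - 2 * R *
    (measureProb V (θ j) (0, 1) (P j *ᵥ x) z + measureProb V (θ j) (1, 0) (P j *ᵥ x) z)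

end RQNN

end

noncomputable section

namespace RQNN

/-! ### The function computed by the circuit -/

/-! The circuit computes an average of functions `R cos γ cos (b + a · (P x, z))`
(`modStateMap_apply`). With `γ = 0`, `P = 1` and equal blocks it is a single neuron `R cos (b + a ·
(x, z))`, so the task is to build a network of cosine neurons with bounded output `R`, for arbitrary
`R`.

A phase `-π/2` turns cosine into sine, and chains of sine neurons act as delay lines: each applies
`u ↦ R sin (R⁻¹ u)` to the previous state of its predecessor. What is stored is not the delayed
input but an injective function of it, which is enough (`injOn_memoryFun`). The chains have no
feedback, so a state is a function of finitely many past inputs. The echo state property thus holds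
without any contraction condition (`isStateSolution_networkParams_iff`).

One more layer takes cosines of affine forms in the stored values. The span of these features is an
algebra by the product-to-sum formula (`feature_mul`) and separates input sequences, so by
Stone–Weierstrass it is dense in the continuous functionals (`exists_feature_combination_near`).
Fading memory makes `z ↦ U(z)_0` such a functional, and time invariance carries the approximation to
every `t`. -/

lemma gateRz_zero : gateRz 0 = 1 := by
  ext i j
  fin_cases i <;> fin_cases j <;> simp [gateRz]

lemma gateRz_mul (α β : ℝ) : gateRz α * gateRz β = gateRz (α + β) := by
  ext i j
  fin_cases i <;> fin_cases j <;> simp [gateRz, Matrix.mul_apply, ← Complex.exp_add] <;>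
    congr 1 <;> ring

lemma prod_map_gateRz {ι : Type*} (f : ι → ℝ) (l : List ι) :
    (l.map fun i => gateRz (f i)).prod = gateRz (l.map f).sum := by
  induction l with
  | nil => simp [gateRz_zero]
  | cons a l ih => simp [ih, gateRz_mul]

lemma sum_map_reverse_finRange {k : ℕ} (f : Fin k → ℝ) :
    ((List.finRange k).reverse.map f).sum = ∑ i, f i := by
  rw [List.map_reverse, List.sum_reverse, ← List.ofFn_eq_map, List.sum_ofFn]

/-- The angle `b + a · (x, z)` of a gate block. -/
def gateAngle {N d : ℕ} (p : GateParams N d) (x : Fin N → ℝ) (z : EuclideanSpace ℝ (Fin d)) : ℝ :=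
  p.b + ∑ i, p.a (Fin.castAdd d i) * x i + ∑ l, p.a (Fin.natAdd N l) * z l

lemma gateU1_eq {N d : ℕ} (p : GateParams N d) (x : Fin N → ℝ) (z : EuclideanSpace ℝ (Fin d)) :
    gateU1 p x z = gateH * gateRz (-gateAngle p x z) * gateH := by
  unfold gateU1
  rw [prod_map_gateRz, prod_map_gateRz, sum_map_reverse_finRange, sum_map_reverse_finRange,
    Matrix.mul_assoc gateH, gateRz_mul, Matrix.mul_assoc gateH, gateRz_mul]
  congr 3
  simp only [gateAngle, Finset.sum_neg_distrib]
  ring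

lemma ofReal_inv_sqrt_two_mul_self :
    ((1 / Real.sqrt 2 : ℝ) : ℂ) * ((1 / Real.sqrt 2 : ℝ) : ℂ) = 1 / 2 := by
  rw [← Complex.ofReal_mul, div_mul_div_comm, Real.mul_self_sqrt (by norm_num)]
  norm_num

/-- Conjugation by the Hadamard gate turns a rotation about Z into one about X. -/
lemma gateH_mul_gateRz_mul_gateH_zero_zero (φ : ℝ) :
    (gateH * gateRz (-φ) * gateH) 0 0 = (Real.cos (φ / 2) : ℂ) := by
  have h := ofReal_inv_sqrt_two_mul_self
  set s : ℂ := ((1 / Real.sqrt 2 : ℝ) : ℂ) with hs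
  have : (gateH * gateRz (-φ) * gateH) 0 0 =
      s * s * (Complex.exp (φ / 2 * Complex.I) + Complex.exp (-(φ / 2) * Complex.I)) := by
    simp only [gateH, gateRz, ← hs, Matrix.mul_apply, Fin.sum_univ_two]
    simp
    ring_nf
  rw [this, h, Complex.ofReal_cos, Complex.cos]
  push_cast
  ring_nf

lemma gateH_mul_gateRz_mul_gateH_one_zero (φ : ℝ) :
    (gateH * gateRz (-φ) * gateH) 1 0 = Complex.I * (Real.sin (φ / 2) : ℂ) := by
  have h := ofReal_inv_sqrt_two_mul_self
  set s : ℂ := ((1 / Real.sqrt 2 : ℝ) : ℂ) with hs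
  have : (gateH * gateRz (-φ) * gateH) 1 0 =
      s * s * (Complex.exp (φ / 2 * Complex.I) - Complex.exp (-(φ / 2) * Complex.I)) := by
    simp only [gateH, gateRz, ← hs, Matrix.mul_apply, Fin.sum_univ_two]
    simp
    ring_nf
  rw [this, h, Complex.ofReal_sin, Complex.sin]
  push_cast
  linear_combination (-1 / 2 * (Complex.exp (-(φ / 2) * Complex.I) -
    Complex.exp (φ / 2 * Complex.I))) * Complex.I_sq

/-- The preparation gate enters only through `V |0⟩`, and the controlled gate is block diagonal:
block `i` acts on `|00⟩` with amplitude `1 / √n`. -/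
lemma circuitState_apply {n N d : ℕ} {V : Matrix (Basis n) (Basis n) ℂ}
    (hV : IsPreparationGate n V) (θ : CircuitParams n N d) (x : Fin N → ℝ)
    (z : EuclideanSpace ℝ (Fin d)) (i : Fin (2 ^ controlQubits n)) (hi : (i : ℕ) < n)
    (q : Fin 2 × Fin 2) :
    circuitState V θ x z (i, q) =
      gateUBar (θ ⟨i, hi⟩) x z q (0, 0) * ((1 / Real.sqrt n : ℝ) : ℂ) := by
  rw [circuitState, ← Matrix.mulVec_mulVec, hV.map_ketZero, Matrix.mulVec, dotProduct,
    Finset.sum_eq_single (i, (0, 0))]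
  · simp [gateU, ketPsi, hi]
  · rintro ⟨k, r⟩ - hne
    by_cases hk : k = i
    · have hr : r ≠ (0, 0) := fun h => hne (by rw [hk, h])
      simp [ketPsi, hr]
    · simp [gateU, Ne.symm hk]
  · simp

lemma sum_fin_two_pow_controlQubits {n : ℕ} (f : Fin n → ℝ) :
    (∑ i : Fin (2 ^ controlQubits n), if h : (i : ℕ) < n then f ⟨i, h⟩ else 0) = ∑ i, f i := by
  have hle : n ≤ 2 ^ controlQubits n := Nat.le_pow_clog one_lt_two n
  have h1 := Finset.sum_range (n := 2 ^ controlQubits n)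
    (fun i => if h : i < n then f ⟨i, h⟩ else (0 : ℝ))
  have h2 := Finset.sum_range (n := n) (fun i => if h : i < n then f ⟨i, h⟩ else (0 : ℝ))
  rw [← h1, ← Finset.sum_subset (Finset.range_subset_range.2 hle), h2]
  · simp
  · intro i _ hi
    simp at hi
    simp [hi]

lemma measureProb_eq {n N d : ℕ} {V : Matrix (Basis n) (Basis n) ℂ}
    (hV : IsPreparationGate n V) (θ : CircuitParams n N d) (q : Fin 2 × Fin 2) (x : Fin N → ℝ)
    (z : EuclideanSpace ℝ (Fin d)) :
    measureProb V θ q x z = ∑ i, ‖gateUBar (θ i) x z q (0, 0)‖ ^ 2 * (1 / n) := by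
  rw [measureProb, ← sum_fin_two_pow_controlQubits
    fun i => ‖gateUBar (θ i) x z q (0, 0)‖ ^ 2 * (1 / (n : ℝ))]
  refine Finset.sum_congr rfl fun i _ => ?_
  split_ifs with hi
  · rw [circuitState_apply hV θ x z i hi, norm_mul, mul_pow, Complex.norm_real, Real.norm_eq_abs,
      sq_abs, div_pow, Real.sq_sqrt (Nat.cast_nonneg n), one_pow]
  · rfl

lemma norm_gateUBar_zero_one {N d : ℕ} (p : GateParams N d) (x : Fin N → ℝ)
    (z : EuclideanSpace ℝ (Fin d)) :
    ‖gateUBar p x z (0, 1) (0, 0)‖ ^ 2 =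
      (Real.cos (gateAngle p x z / 2) * Real.sin (p.γ / 2)) ^ 2 := by
  rw [gateUBar, Matrix.kroneckerMap_apply, gateU1_eq, gateH_mul_gateRz_mul_gateH_zero_zero]
  have : gateU2 p 1 0 = (Real.sin (p.γ / 2) : ℂ) := rfl
  rw [this, ← Complex.ofReal_mul, Complex.norm_real, Real.norm_eq_abs, sq_abs]

lemma norm_gateUBar_one_zero {N d : ℕ} (p : GateParams N d) (x : Fin N → ℝ)
    (z : EuclideanSpace ℝ (Fin d)) :
    ‖gateUBar p x z (1, 0) (0, 0)‖ ^ 2 =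
      (Real.sin (gateAngle p x z / 2) * Real.cos (p.γ / 2)) ^ 2 := by
  rw [gateUBar, Matrix.kroneckerMap_apply, gateU1_eq, gateH_mul_gateRz_mul_gateH_one_zero]
  have : gateU2 p 0 0 = (Real.cos (p.γ / 2) : ℂ) := rfl
  rw [this, mul_assoc, ← Complex.ofReal_mul, norm_mul, Complex.norm_I, one_mul,
    Complex.norm_real, Real.norm_eq_abs, sq_abs]

/-- The bracket is the probability that exactly one of two independent qubits is flipped; by the
half-angle formulas this parity yields a product of cosines. -/
lemma two_mul_sq_cos_sin_half_add (φ γ : ℝ) :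
    2 * ((Real.cos (φ / 2) * Real.sin (γ / 2)) ^ 2 + (Real.sin (φ / 2) * Real.cos (γ / 2)) ^ 2) =
      1 - Real.cos γ * Real.cos φ := by
  have h1 := Real.cos_sq (φ / 2)
  have h2 := Real.cos_sq (γ / 2)
  rw [mul_div_cancel₀ _ two_ne_zero] at h1 h2
  rw [mul_pow, mul_pow, Real.sin_sq, Real.sin_sq, h1, h2]
  ring

/-- The state map of the modified network is the average of the `n` functions
`R cos γ cos (b + a · (P x, z))`. -/
theorem modStateMap_apply {n N d : ℕ} (hn : 0 < n) {V : Matrix (Basis n) (Basis n) ℂ}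
    (hV : IsPreparationGate n V) (R : ℝ) (P : Fin N → Matrix (Fin N) (Fin N) ℝ)
    (θ : Fin N → CircuitParams n N d) (x : Fin N → ℝ) (z : EuclideanSpace ℝ (Fin d)) (j : Fin N) :
    modStateMap V R P θ x z j =
      R / n * ∑ i, Real.cos (θ j i).γ * Real.cos (gateAngle (θ j i) (P j *ᵥ x) z) := by
  have hn' : (n : ℝ) ≠ 0 := by positivity
  have key : 2 * (measureProb V (θ j) (0, 1) (P j *ᵥ x) z +
      measureProb V (θ j) (1, 0) (P j *ᵥ x) z) =
      1 - (∑ i, Real.cos (θ j i).γ * Real.cos (gateAngle (θ j i) (P j *ᵥ x) z)) / n := by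
    rw [measureProb_eq hV, measureProb_eq hV, ← Finset.sum_add_distrib, Finset.mul_sum]
    have : ∀ i ∈ Finset.univ, 2 * (‖gateUBar (θ j i) (P j *ᵥ x) z (0, 1) (0, 0)‖ ^ 2 * (1 / (n : ℝ))
        + ‖gateUBar (θ j i) (P j *ᵥ x) z (1, 0) (0, 0)‖ ^ 2 * (1 / (n : ℝ))) =
        (1 - Real.cos (θ j i).γ * Real.cos (gateAngle (θ j i) (P j *ᵥ x) z)) / n := by
      intro i _
      rw [norm_gateUBar_zero_one, norm_gateUBar_one_zero, ← two_mul_sq_cos_sin_half_add]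
      ring
    rw [Finset.sum_congr rfl this, ← Finset.sum_div, Finset.sum_sub_distrib, sub_div]
    simp [hn']
  rw [modStateMap, mul_comm 2 R, mul_assoc, key]
  ring

/-- Circuit parameters, with all `n` blocks equal, producing a single cosine neuron. -/
def cosineParams (n : ℕ) {N d : ℕ} (b : ℝ) (a : Fin N → ℝ) (c : Fin d → ℝ) :
    CircuitParams n N d := fun _ =>
  { a := Fin.append a c
    b := b
    γ := ⟨0, le_rfl, by positivity⟩ }

lemma modStateMap_cosineParams {n N d : ℕ} (hn : 0 < n) {V : Matrix (Basis n) (Basis n) ℂ}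
    (hV : IsPreparationGate n V) (R : ℝ) (b : Fin N → ℝ) (a : Fin N → Fin N → ℝ)
    (c : Fin N → Fin d → ℝ) (x : Fin N → ℝ) (z : EuclideanSpace ℝ (Fin d)) (j : Fin N) :
    modStateMap V R (fun _ => 1) (fun j => cosineParams n (b j) (a j) (c j)) x z j =
      R * Real.cos (b j + ∑ i, a j i * x i + ∑ l, c j l * z l) := by
  have hn' : (n : ℝ) ≠ 0 := by positivity
  rw [modStateMap_apply hn hV]
  simp [cosineParams, gateAngle]
  field_simp

/-! ### Cosine features of the input history -/

/-- The function of `u` stored by a chain of `k` memory neurons. -/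
def memoryFun (R δ : ℝ) : ℕ → ℝ → ℝ
  | 0, u => R * δ * u
  | k + 1, u => R * Real.sin (R⁻¹ * memoryFun R δ k u)

lemma continuous_memoryFun (R δ : ℝ) (k : ℕ) : Continuous (memoryFun R δ k) := by
  induction k with
  | zero =>
    change Continuous fun u => R * δ * u
    fun_prop
  | succ k ih =>
    change Continuous fun u => R * Real.sin (R⁻¹ * memoryFun R δ k u)
    fun_prop

/-- The two claims are proved together: the bound by `1 < π/2` keeps the argument of the next sine
in the interval where sine is injective. The factor `δ` provides the bound at the start of the
chain. -/
lemma injOn_memoryFun {R δ : ℝ} (hR : 0 < R) (hδ : 0 < δ) (k : ℕ) :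
    Set.InjOn (memoryFun R δ k) {u | |δ * u| ≤ 1} ∧
      ∀ u, |δ * u| ≤ 1 → |R⁻¹ * memoryFun R δ k u| ≤ 1 := by
  induction k with
  | zero =>
    refine ⟨fun u _ v _ h => ?_, fun u hu => ?_⟩
    · exact mul_left_cancel₀ (by positivity) h
    · rwa [memoryFun, mul_assoc, inv_mul_cancel_left₀ hR.ne']
  | succ k ih =>
    have hmem : ∀ u, |δ * u| ≤ 1 →
        R⁻¹ * memoryFun R δ k u ∈ Set.Icc (-(Real.pi / 2)) (Real.pi / 2) := fun u hu => by
      have h := abs_le.1 (ih.2 u hu)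
      have := Real.pi_gt_three
      constructor <;> linarith
    refine ⟨fun u hu v hv h => ih.1 hu hv ?_, fun u _ => ?_⟩
    · exact mul_left_cancel₀ (inv_ne_zero hR.ne') (Real.injOn_sin (hmem u hu) (hmem v hv)
        (mul_left_cancel₀ hR.ne' h))
    · rw [memoryFun, inv_mul_cancel_left₀ hR.ne']
      exact Real.abs_sin_le_one _

/-- Parameters of a cosine feature: a phase and finitely many weights, indexed by a delay and an
input coordinate. -/
abbrev FeatureParams (d : ℕ) : Type := ℝ × (ℕ × Fin d →₀ ℝ)

/-- The linear form, with weights `a`, in the stored functions of the input history at time `t`. -/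
def historyForm {d : ℕ} (R δ : ℝ) (a : ℕ × Fin d →₀ ℝ)
    (z : ZMinus → EuclideanSpace ℝ (Fin d)) (t : ZMinus) : ℝ :=
  a.sum fun q c => c * memoryFun R δ q.1 (z (ZMinus.back q.1 t) q.2)

/-- The cosine feature of the input history at time `t`. -/
def feature {d : ℕ} (R δ : ℝ) (p : FeatureParams d)
    (z : ZMinus → EuclideanSpace ℝ (Fin d)) (t : ZMinus) : ℝ :=
  Real.cos (p.1 + historyForm R δ p.2 z t)

lemma ZMinus.back_back (j k : ℕ) (t : ZMinus) :
    ZMinus.back j (ZMinus.back k t) = ZMinus.back (k + j) t := by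
  apply Subtype.ext
  simp only [ZMinus.back]
  push_cast
  ring

lemma ZMinus.back_zero (t : ZMinus) : ZMinus.back 0 t = t := by
  apply Subtype.ext
  simp [ZMinus.back]

lemma ZMinus.exists_eq_back (t : ZMinus) : ∃ τ : ℕ, t = ZMinus.back τ ⟨0, le_rfl⟩ := by
  have := t.2
  refine ⟨(-t.1).toNat, Subtype.ext ?_⟩
  simp only [ZMinus.back]
  omega

lemma feature_timeDelay {d : ℕ} (R δ : ℝ) (p : FeatureParams d)
    (z : ZMinus → EuclideanSpace ℝ (Fin d)) (τ : ℕ) (t : ZMinus) :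
    feature R δ p (timeDelay τ z) t = feature R δ p z (ZMinus.back τ t) := by
  simp only [feature, historyForm, timeDelay, ZMinus.back_back, add_comm]

lemma historyForm_add {d : ℕ} (R δ : ℝ) (a b : ℕ × Fin d →₀ ℝ)
    (z : ZMinus → EuclideanSpace ℝ (Fin d)) (t : ZMinus) :
    historyForm R δ (a + b) z t = historyForm R δ a z t + historyForm R δ b z t :=
  Finsupp.sum_add_index' (by simp) (by intros; ring)

lemma historyForm_sub {d : ℕ} (R δ : ℝ) (a b : ℕ × Fin d →₀ ℝ)
    (z : ZMinus → EuclideanSpace ℝ (Fin d)) (t : ZMinus) :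
    historyForm R δ (a - b) z t = historyForm R δ a z t - historyForm R δ b z t :=
  Finsupp.sum_sub_index (by intros; ring)

lemma historyForm_single {d : ℕ} (R δ : ℝ) (q : ℕ × Fin d) (c : ℝ)
    (z : ZMinus → EuclideanSpace ℝ (Fin d)) (t : ZMinus) :
    historyForm R δ (Finsupp.single q c) z t =
      c * memoryFun R δ q.1 (z (ZMinus.back q.1 t) q.2) :=
  Finsupp.sum_single_index (by simp)

lemma feature_mul {d : ℕ} (R δ : ℝ) (p q : FeatureParams d)
    (z : ZMinus → EuclideanSpace ℝ (Fin d)) (t : ZMinus) :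
    feature R δ p z t * feature R δ q z t =
      (1 / 2 : ℝ) * feature R δ (p - q) z t + (1 / 2 : ℝ) * feature R δ (p + q) z t := by
  simp only [feature, Prod.fst_sub, Prod.snd_sub, Prod.fst_add, Prod.snd_add, historyForm_add,
    historyForm_sub]
  have h := Real.two_mul_cos_mul_cos (p.1 + historyForm R δ p.2 z t)
    (q.1 + historyForm R δ q.2 z t)
  rw [add_sub_add_comm, add_add_add_comm] at h
  linarith

/-! ### Density of the cosine features -/

section Density

variable {d : ℕ} (D : Set (EuclideanSpace ℝ (Fin d))) (R δ : ℝ)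

/-- The cosine feature at time `0`, as a continuous function on the space of inputs in `D`. -/
def featureMap (p : FeatureParams d) : C(ZMinus → D, ℝ) where
  toFun z := feature R δ p (fun s => z s) ⟨0, le_rfl⟩
  continuous_toFun := by
    unfold feature historyForm Finsupp.sum
    have h := continuous_memoryFun R δ
    fun_prop

lemma featureMap_mul (p q : FeatureParams d) :
    featureMap D R δ p * featureMap D R δ q =
      (1 / 2 : ℝ) • featureMap D R δ (p - q) + (1 / 2 : ℝ) • featureMap D R δ (p + q) := by
  ext z
  exact feature_mul R δ p q _ _

lemma featureMap_zero : featureMap D R δ 0 = 1 := by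
  ext z
  simp [featureMap, feature, historyForm]

/-- The span of the cosine features, a subalgebra of the continuous functions. -/
def featureAlgebra : Subalgebra ℝ C(ZMinus → D, ℝ) :=
  (Submodule.span ℝ (Set.range (featureMap D R δ))).toSubalgebra
    (by rw [← featureMap_zero D R δ]; exact Submodule.subset_span ⟨0, rfl⟩)
    (by
      intro f g hf hg
      have h : Submodule.span ℝ (Set.range (featureMap D R δ)) *
          Submodule.span ℝ (Set.range (featureMap D R δ)) ≤
          Submodule.span ℝ (Set.range (featureMap D R δ)) := by
        rw [Submodule.span_mul_span, Submodule.span_le]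
        rintro _ ⟨_, ⟨p, rfl⟩, _, ⟨q, rfl⟩, rfl⟩
        change featureMap D R δ p * featureMap D R δ q ∈ _
        rw [featureMap_mul]
        exact Submodule.add_mem _ (Submodule.smul_mem _ _ (Submodule.subset_span ⟨_, rfl⟩))
          (Submodule.smul_mem _ _ (Submodule.subset_span ⟨_, rfl⟩))
      exact h (Submodule.mul_mem_mul hf hg))

variable {D R δ}

/-- If two sequences differ at delay `k` in coordinate `l`, the feature `sin (R⁻¹ · memoryFun R δ
k)` of that entry tells them apart: up to the factor `R` it is the injective function `memoryFun R δ
(k + 1)`. -/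
lemma featureAlgebra_separatesPoints (hR : 0 < R) (hδ : 0 < δ)
    (hD : ∀ u ∈ D, ∀ l, |δ * u l| ≤ 1) : (featureAlgebra D R δ).SeparatesPoints := by
  intro z w hzw
  obtain ⟨s, hs⟩ := Function.ne_iff.1 hzw
  obtain ⟨l, hl⟩ : ∃ l, (z s : EuclideanSpace ℝ (Fin d)) l ≠ (w s : EuclideanSpace ℝ (Fin d)) l := by
    by_contra! h
    exact hs (Subtype.ext (PiLp.ext h))
  obtain ⟨k, hk⟩ := s.exists_eq_back
  refine ⟨_, ⟨featureMap D R δ (-(Real.pi / 2), Finsupp.single (k, l) R⁻¹),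
    Submodule.subset_span ⟨_, rfl⟩, rfl⟩, fun h => hl ?_⟩
  refine (injOn_memoryFun hR hδ (k + 1)).1 (hD _ (z s).2 l) (hD _ (w s).2 l) ?_
  simp only [featureMap, ContinuousMap.coe_mk, feature, historyForm_single, neg_add_eq_sub,
    Real.cos_sub_pi_div_two, ← hk] at h
  simp only [memoryFun, h]

/-- Cosine features are uniformly dense in the continuous functionals. -/
theorem exists_feature_combination_near (hDc : IsCompact D) (hR : 0 < R) (hδ : 0 < δ)
    (hD : ∀ u ∈ D, ∀ l, |δ * u l| ≤ 1) (f : C(ZMinus → D, ℝ)) {η : ℝ} (hη : 0 < η) :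
    ∃ c : FeatureParams d →₀ ℝ, ∀ z : ZMinus → D,
      |f z - c.sum fun p w => w * feature R δ p (fun s => z s) ⟨0, le_rfl⟩| < η := by
  -- With `D` compact, the sequence space is compact by Tychonoff's theorem.
  have : CompactSpace D := isCompact_iff_compactSpace.1 hDc
  obtain ⟨g, hg⟩ := ContinuousMap.exists_mem_subalgebra_near_continuousMap_of_separatesPoints
    (featureAlgebra D R δ) (featureAlgebra_separatesPoints hR hδ hD) f η hη
  obtain ⟨c, hc⟩ := Finsupp.mem_span_range_iff_exists_finsupp.1
    (show (g : C(ZMinus → D, ℝ)) ∈ Submodule.span ℝ (Set.range (featureMap D R δ)) from g.2)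
  refine ⟨c, fun z => ?_⟩
  have h := (ContinuousMap.norm_coe_le_norm ((g : C(ZMinus → D, ℝ)) - f) z).trans_lt hg
  rw [← hc, ContinuousMap.sub_apply, Real.norm_eq_abs, abs_sub_comm, Finsupp.sum,
    ContinuousMap.sum_apply] at h
  exact h

end Density

/-! ### Realization of the cosine features by a recurrent network -/

section Realization

variable {d T N : ℕ} {J : Finset (FeatureParams d)}

/-- Neurons: one for each of `T` delays and each input coordinate, and one for each feature
in `J`. -/
abbrev Neuron (d T : ℕ) (J : Finset (FeatureParams d)) : Type := (Fin T × Fin d) ⊕ J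

/-- The feature computed by a neuron; memory neurons store the delayed inputs. -/
def neuronParams (R : ℝ) : Neuron d T J → FeatureParams d
  | .inl q => (-(Real.pi / 2), Finsupp.single ((q.1 : ℕ), q.2) R⁻¹)
  | .inr p => p

/-- The weights with which the previous state enters a neuron. -/
def stateWeight (R : ℝ) (s : Neuron d T J) : Neuron d T J → ℝ
  | .inl q => (neuronParams R s).2 ((q.1 : ℕ) + 1, q.2)
  | .inr _ => 0

/-- The weights with which the current input enters a neuron. -/
def inputWeight (R δ : ℝ) (s : Neuron d T J) (l : Fin d) : ℝ :=
  (neuronParams R s).2 (0, l) * (R * δ)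

/-- The circuits realizing the network of cosine neurons. -/
def networkParams (n : ℕ) (e : Fin N ≃ Neuron d T J) (R δ : ℝ) : Fin N → CircuitParams n N d :=
  fun j => cosineParams n (neuronParams R (e j)).1 (fun i => stateWeight R (e j) (e i))
    (inputWeight R δ (e j))

lemma modStateMap_networkParams {n : ℕ} (hn : 0 < n) {V : Matrix (Basis n) (Basis n) ℂ}
    (hV : IsPreparationGate n V) (e : Fin N ≃ Neuron d T J) (R δ : ℝ) (x : Fin N → ℝ)
    (z : EuclideanSpace ℝ (Fin d)) (j : Fin N) :
    modStateMap V R (fun _ => 1) (networkParams n e R δ) x z j =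
      R * Real.cos ((neuronParams R (e j)).1 +
        (∑ k : Fin T, ∑ l, (neuronParams R (e j)).2 ((k : ℕ) + 1, l) * x (e.symm (.inl (k, l))) +
          ∑ l, (neuronParams R (e j)).2 (0, l) * memoryFun R δ 0 (z l))) := by
  unfold networkParams
  rw [modStateMap_cosineParams hn hV, add_assoc]
  congr 4
  · rw [← Equiv.sum_comp e.symm]
    simp [stateWeight, Fintype.sum_prod_type]
  · simp [inputWeight, memoryFun, mul_assoc]

/-- Delay `0` is read from the current input; delay `k + 1` at time `t` is delay `k` at time `t -
1`, available in the previous state. -/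
lemma historyForm_eq_sum (R δ : ℝ) (a : ℕ × Fin d →₀ ℝ) (ha : ∀ q ∈ a.support, q.1 ≤ T)
    (z : ZMinus → EuclideanSpace ℝ (Fin d)) (t : ZMinus) :
    historyForm R δ a z t =
      ∑ k : Fin T, ∑ l, a ((k : ℕ) + 1, l) *
        memoryFun R δ (k + 1) (z (ZMinus.back k (ZMinus.back 1 t)) l) +
      ∑ l, a (0, l) * memoryFun R δ 0 (z t l) := by
  rw [historyForm, Finsupp.sum_of_support_subset (s := Finset.range (T + 1) ×ˢ Finset.univ),
    Finset.sum_product, Finset.sum_range_succ', Finset.sum_range]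
  · simp [ZMinus.back_back, ZMinus.back_zero, add_comm]
  · intro q hq
    simpa [Nat.lt_succ_iff] using ha q (by simpa using hq)
  · simp

lemma neuronParams_support_le {R : ℝ} (hJ : ∀ p ∈ J, ∀ q ∈ p.2.support, q.1 ≤ T)
    (s : Neuron d T J) : ∀ q ∈ (neuronParams R s).2.support, q.1 ≤ T := by
  rcases s with ⟨k, l⟩ | p
  · intro q hq
    have h := Finset.mem_singleton.1 (Finsupp.support_single_subset hq)
    rw [h]
    exact k.2.le
  · exact hJ p.1 p.2

lemma memory_feature (R δ : ℝ) (q : Fin T × Fin d) (z : ZMinus → EuclideanSpace ℝ (Fin d))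
    (t : ZMinus) :
    R * feature R δ (neuronParams R (.inl q : Neuron d T J)) z t =
      memoryFun R δ (q.1 + 1) (z (ZMinus.back q.1 t) q.2) := by
  simp only [neuronParams, feature, historyForm_single, neg_add_eq_sub, Real.cos_sub_pi_div_two,
    memoryFun]

/-- Correct memory is required only where the weight is nonzero; this lets correctness propagate
along a chain by induction. -/
lemma modStateMap_eq_feature {n : ℕ} (hn : 0 < n) {V : Matrix (Basis n) (Basis n) ℂ}
    (hV : IsPreparationGate n V) (e : Fin N ≃ Neuron d T J) (R δ : ℝ) (x : Fin N → ℝ)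
    (hJ : ∀ p ∈ J, ∀ q ∈ p.2.support, q.1 ≤ T)
    (z : ZMinus → EuclideanSpace ℝ (Fin d)) (t : ZMinus) (j : Fin N)
    (hx : ∀ (k : Fin T) (l : Fin d), (neuronParams R (e j)).2 ((k : ℕ) + 1, l) ≠ 0 →
      x (e.symm (.inl (k, l))) = memoryFun R δ (k + 1) (z (ZMinus.back k (ZMinus.back 1 t)) l)) :
    modStateMap V R (fun _ => 1) (networkParams n e R δ) x (z t) j =
      R * feature R δ (neuronParams R (e j)) z t := by
  rw [modStateMap_networkParams hn hV, feature,
    historyForm_eq_sum R δ _ (neuronParams_support_le hJ (e j))]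
  congr 4
  refine Finset.sum_congr rfl fun k _ => Finset.sum_congr rfl fun l _ => ?_
  by_cases h : (neuronParams R (e j)).2 ((k : ℕ) + 1, l) = 0
  · rw [h, zero_mul, zero_mul]
  · rw [hx k l h]

/-- The state equation of the network has exactly one solution: the features of the input
history. -/
theorem isStateSolution_networkParams_iff {n : ℕ} (hn : 0 < n)
    {V : Matrix (Basis n) (Basis n) ℂ} (hV : IsPreparationGate n V) (e : Fin N ≃ Neuron d T J)
    (R δ : ℝ) (hJ : ∀ p ∈ J, ∀ q ∈ p.2.support, q.1 ≤ T)
    (z : ZMinus → EuclideanSpace ℝ (Fin d)) (x : ZMinus → Fin N → ℝ) :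
    IsStateSolution (modStateMap V R (fun _ => 1) (networkParams n e R δ)) z x ↔
      x = fun t j => R * feature R δ (neuronParams R (e j)) z t := by
  constructor
  · intro hx
    have hmem : ∀ (k : ℕ) (hk : k < T) (l : Fin d) (t : ZMinus),
        x t (e.symm (.inl (⟨k, hk⟩, l))) = memoryFun R δ (k + 1) (z (ZMinus.back k t) l) := by
      intro k
      induction k with
      -- The first neuron of a chain reads only the current input, so all its state weights vanish.
      | zero =>
        intro hk l t
        rw [hx t, modStateMap_eq_feature hn hV e R δ _ hJ, e.apply_symm_apply, memory_feature]
        intro k' l' h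
        simp [neuronParams] at h
      | succ k ih =>
        intro hk l t
        rw [hx t, modStateMap_eq_feature hn hV e R δ _ hJ, e.apply_symm_apply, memory_feature]
        intro k' l' h
        -- The only state entry read by neuron `k + 1` is neuron `k` of the same chain.
        have hk' : k = k' := by
          simp only [e.apply_symm_apply, neuronParams, Finsupp.single_apply, Prod.mk.injEq] at h
          by_contra hne
          exact h (if_neg fun h' => hne (by omega))
        obtain ⟨k', hk''⟩ := k'
        subst hk'
        exact ih _ _ _
    funext t j
    rw [hx t, modStateMap_eq_feature hn hV e R δ _ hJ]
    intro k l _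
    exact hmem k k.2 l _
  · rintro rfl t
    funext j
    rw [modStateMap_eq_feature hn hV e R δ _ hJ]
    intro k l _
    simp only [e.apply_symm_apply, memory_feature]

lemma echoStateProperty_networkParams {n : ℕ} (hn : 0 < n)
    {V : Matrix (Basis n) (Basis n) ℂ} (hV : IsPreparationGate n V) (e : Fin N ≃ Neuron d T J)
    (R δ : ℝ) (hJ : ∀ p ∈ J, ∀ q ∈ p.2.support, q.1 ≤ T) (D : Set (EuclideanSpace ℝ (Fin d))) :
    EchoStateProperty (modStateMap V R (fun _ => 1) (networkParams n e R δ)) D := fun _ =>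
  ⟨_, (isStateSolution_networkParams_iff hn hV e R δ hJ _ _).2 rfl,
    fun _ hy => (isStateSolution_networkParams_iff hn hV e R δ hJ _ _).1 hy⟩

lemma stateFilter_networkParams {n : ℕ} (hn : 0 < n)
    {V : Matrix (Basis n) (Basis n) ℂ} (hV : IsPreparationGate n V) (e : Fin N ≃ Neuron d T J)
    (R δ : ℝ) (hJ : ∀ p ∈ J, ∀ q ∈ p.2.support, q.1 ≤ T) {D : Set (EuclideanSpace ℝ (Fin d))}
    (h : EchoStateProperty (modStateMap V R (fun _ => 1) (networkParams n e R δ)) D)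
    (z : ZMinus → D) (t : ZMinus) (j : Fin N) :
    stateFilter h z t j = R * feature R δ (neuronParams R (e j)) (fun s => z s) t :=
  congrFun (congrFun ((isStateSolution_networkParams_iff hn hV e R δ hJ _ _).1
    (h z).choose_spec.1) t) j

/-- The readout forming, for each output coordinate, a given combination of the features. -/
def networkReadout {m : ℕ} (e : Fin N ≃ Neuron d T J) (R : ℝ)
    (c : Fin m → FeatureParams d →₀ ℝ) : Matrix (Fin m) (Fin N) ℝ :=
  Matrix.of fun i j => match e j with
    | .inl _ => 0
    | .inr p => c i p * R⁻¹

lemma outputFilter_networkParams {n m : ℕ} (hn : 0 < n)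
    {V : Matrix (Basis n) (Basis n) ℂ} (hV : IsPreparationGate n V) (e : Fin N ≃ Neuron d T J)
    {R : ℝ} (hR : 0 < R) (δ : ℝ) (hJ : ∀ p ∈ J, ∀ q ∈ p.2.support, q.1 ≤ T)
    {D : Set (EuclideanSpace ℝ (Fin d))}
    (h : EchoStateProperty (modStateMap V R (fun _ => 1) (networkParams n e R δ)) D)
    (c : Fin m → FeatureParams d →₀ ℝ) (hc : ∀ i, (c i).support ⊆ J)
    (z : ZMinus → D) (t : ZMinus) (i : Fin m) :
    outputFilter h (networkReadout e R c) z t i =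
      (c i).sum fun p w => w * feature R δ p (fun s => z s) t := by
  change ∑ j, networkReadout e R c i j * stateFilter h z t j = _
  simp only [stateFilter_networkParams hn hV e R δ hJ]
  rw [← Equiv.sum_comp e.symm, Fintype.sum_sum_type,
    Finsupp.sum_of_support_subset _ (hc i) _ (by simp), ← Finset.sum_coe_sort J]
  simp only [networkReadout, Matrix.of_apply, e.apply_symm_apply, neuronParams, zero_mul,
    Finset.sum_const_zero, zero_add]
  refine Finset.sum_congr rfl fun p _ => ?_
  rw [mul_assoc, inv_mul_cancel_left₀ hR.ne']

end Realization

/-! ### Approximation of the filter -/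

lemma norm_le_of_forall_abs_le {m : ℕ} {η : ℝ} (v : EuclideanSpace ℝ (Fin m))
    (h : ∀ i, |v i| ≤ η) : ‖v‖ ≤ m * η := by
  have h1 : ‖v‖ ≤ ∑ i, |v i| := by
    rw [EuclideanSpace.norm_eq]
    refine Real.sqrt_le_iff.2 ⟨Finset.sum_nonneg fun i _ => abs_nonneg _, ?_⟩
    simp only [Real.norm_eq_abs]
    exact Finset.sum_sq_le_sq_sum_of_nonneg fun i _ => abs_nonneg _
  refine h1.trans ((Finset.sum_le_sum fun i _ => h i).trans ?_)
  simp

lemma exists_pos_forall_abs_mul_le_one {d : ℕ} {D : Set (EuclideanSpace ℝ (Fin d))}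
    (hD : IsCompact D) : ∃ δ : ℝ, 0 < δ ∧ ∀ u ∈ D, ∀ l, |δ * u l| ≤ 1 := by
  obtain ⟨M, hM0, hM⟩ := hD.isBounded.exists_pos_norm_le
  refine ⟨M⁻¹, inv_pos.2 hM0, fun u hu l => ?_⟩
  rw [abs_mul, abs_of_pos (inv_pos.2 hM0), inv_mul_le_one₀ hM0]
  exact (PiLp.norm_apply_le u l).trans (hM u hu)

/-- Universality holds for every fixed number `n ≥ 1` of blocks per circuit. -/
theorem exists_network_near {d m n : ℕ} (hn : 0 < n) {V : Matrix (Basis n) (Basis n) ℂ}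
    (hV : IsPreparationGate n V)
    {D : Set (EuclideanSpace ℝ (Fin d))} (hD : IsCompact D) {B : Set (EuclideanSpace ℝ (Fin m))}
    {U : (ZMinus → D) → (ZMinus → B)} (hinv : IsTimeInvariant U) (hfmp : HasFadingMemory U)
    {R : ℝ} (hR : 0 < R) {ε : ℝ} (hε : 0 < ε) :
    ∃ (N : ℕ) (_ : 0 < N) (P : Fin N → Matrix (Fin N) (Fin N) ℝ) (W : Matrix (Fin m) (Fin N) ℝ)
      (θ : Fin N → CircuitParams n N d) (hESP : EchoStateProperty (modStateMap V R P θ) D),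
      ∀ (z : ZMinus → D) (t : ZMinus),
        ‖(U z t : EuclideanSpace ℝ (Fin m)) - outputFilter hESP W z t‖ ≤ ε := by
  classical
  obtain ⟨δ, hδ, hDδ⟩ := exists_pos_forall_abs_mul_le_one hD
  have hcont : Continuous fun z : ZMinus → D =>
      (U z ⟨0, le_rfl⟩ : EuclideanSpace ℝ (Fin m)) :=
    continuous_subtype_val.comp ((continuous_apply _).comp hfmp)
  -- Coordinatewise errors add up to at most `m * (ε / (m + 1)) ≤ ε`; the `+ 1` covers `m = 0`.
  have hη : 0 < ε / (m + 1) := by positivity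
  choose c hc using fun i : Fin m => exists_feature_combination_near hD hR hδ hDδ
    ⟨fun z => (U z ⟨0, le_rfl⟩ : EuclideanSpace ℝ (Fin m)) i, by fun_prop⟩ hη
  -- Inserting `0` guarantees at least one neuron, hence `0 < N`.
  let J : Finset (FeatureParams d) := insert 0 (Finset.univ.biUnion fun i => (c i).support)
  have hcJ : ∀ i, (c i).support ⊆ J := fun i =>
    (Finset.subset_biUnion_of_mem (fun i => (c i).support) (Finset.mem_univ i)).trans
      (Finset.subset_insert _ _)
  let T : ℕ := J.sup fun p => p.2.support.sup Prod.fst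
  have hJ : ∀ p ∈ J, ∀ q ∈ p.2.support, q.1 ≤ T := fun p hp q hq =>
    (Finset.le_sup (f := Prod.fst) hq).trans
      (Finset.le_sup (f := fun p : FeatureParams d => p.2.support.sup Prod.fst) hp)
  let e : Fin (Fintype.card (Neuron d T J)) ≃ Neuron d T J := (Fintype.equivFin _).symm
  have hN : 0 < Fintype.card (Neuron d T J) :=
    Fintype.card_pos_iff.2 ⟨.inr ⟨0, Finset.mem_insert_self _ _⟩⟩
  refine ⟨_, hN, fun _ => 1, networkReadout e R c, networkParams n e R δ,
    echoStateProperty_networkParams hn hV e R δ hJ D, fun z t => ?_⟩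
  refine (norm_le_of_forall_abs_le _ fun i => ?_).trans (?_ : m * (ε / (m + 1)) ≤ ε)
  -- Both the filter and the features at time `-τ` equal their values at time `0` on the delayed
  -- input, where the approximation applies.
  · obtain ⟨τ, rfl⟩ := t.exists_eq_back
    have h := (hc i (timeDelay τ z)).le
    rw [PiLp.sub_apply, outputFilter_networkParams hn hV e hR δ hJ _ c hcJ]
    have hfeat : ∀ p : FeatureParams d, feature R δ p (fun s => (timeDelay τ z s : _))
        ⟨0, le_rfl⟩ = feature R δ p (fun s => z s) (ZMinus.back τ ⟨0, le_rfl⟩) := fun p =>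
      feature_timeDelay R δ p (fun s => (z s : EuclideanSpace ℝ (Fin d))) τ _
    simp only [hfeat, ContinuousMap.coe_mk, hinv τ z] at h
    exact h
  · rw [mul_div_assoc', div_le_iff₀ (by positivity)]
    nlinarith

end RQNN

end

theorem mainTheorem2 {d m : ℕ}
    (D : Set (EuclideanSpace ℝ (Fin d))) (hD : IsCompact D)
    (B : Set (EuclideanSpace ℝ (Fin m))) (hB : IsCompact B)
    (U : (RQNN.ZMinus → D) → (RQNN.ZMinus → B))
    (hcausal : RQNN.IsCausal U) (hinv : RQNN.IsTimeInvariant U) (hfmp : RQNN.HasFadingMemory U)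
    (V : ∀ n : ℕ, Matrix (RQNN.Basis n) (RQNN.Basis n) ℂ)
    (hV : ∀ n : ℕ, 0 < n → RQNN.IsPreparationGate n (V n))
    (R : ℝ) (hR : 0 < R) (ε : ℝ) (hε : 0 < ε) :
    ∃ (n N : ℕ) (_ : 0 < n) (_ : 0 < N)
      (P : Fin N → Matrix (Fin N) (Fin N) ℝ)
      (W : Matrix (Fin m) (Fin N) ℝ)
      (θ : Fin N → RQNN.CircuitParams n N d)
      (hESP : RQNN.EchoStateProperty (RQNN.modStateMap (V n) R P θ) D),
      ∀ (z : RQNN.ZMinus → D) (t : RQNN.ZMinus),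
        ‖(U z t : EuclideanSpace ℝ (Fin m)) - RQNN.outputFilter hESP W z t‖ ≤ ε := by
  obtain ⟨N, hN, P, W, θ, hESP, h⟩ :=
    RQNN.exists_network_near one_pos (hV 1 one_pos) hD hinv hfmp hR hε
  exact ⟨1, N, one_pos, hN, P, W, θ, hESP, h⟩
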